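/- **Setting.** $N$ processes sit at distinct points $(x_i,y_i)$ of the plane and communicate by a synchronous, fully connected message-passing network (in every round each process sends a message to each process; the receiver knows the sender). There are $M\ge 1$ closed fault squares $F_1,\dots,F_M$, all of the same known side, at unknown locations. Any process covered by some $F_i$ (interior or boundary) may be Byzantine, i.e. send arbitrary messages; all other processes are correct. Let $f$ be the number of faulty processes. Every process has an input in $\{0,1\}$. An algorithm *solves geoconsensus* if in every computation each correct process eventually makes an irrevocable decision in $\{0,1\}$, no two correct processes decide differently, and if all correct processes have the same input $v$ then all of them decide $v$. **Greedy cover.** Fix $\ell>0$. Sweep upwards: the first slab $b\le y\le b+\ell$ starts at the lowest $y$-coordinate $b$ of a process, the next one at the lowest $y$-coordinate of a process not in the previous slabs, and so on. In each slab sweep to the right: the first square $[a,a+\ell]\times[b,b+\ell]$ has as $a$ the least $x$-coordinate of a process of the slab, the next one the least $x$-coordinate of a process of the slab not covered so far, and so on. Let $\mathcal A$ be the set of all these axis-aligned $\ell\times\ell$ squares. The leader of a square is the process in it with the least $y$-coordinate and, among those, the least $x$-coordinate; $P_L$ is the set of leaders. **PSL.** Let $m\geq 0$. In $m+1$ rounds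 each member $p$ of a set $P$ relays to all of $P$ everything it has heard, so that $p$ obtains a value $\sigma_p(p\,p_1\cdots p_r)\in\{0,1\}$ for every string over $P$ with $1\le r\le m+1$: what $p_1$ told $p$ that $p_2$ told $p_1$ $\dots$ that $p_r$'s input is (a missing value is read as $0$). With $n=|P|$, $p$ records a value for each $q\in P$ as follows. (1) If for some $Q\subseteq P$ with $|Q|>(n+m)/2$ and some $v$ one has $\sigma_p(pwq)=v$ for all strings $w$ over $Q$ of length at most $m$, it records $v$. (2) Otherwise, if $m\ge1$, it applies the procedure with $m-1$, $P\setminus\{q\}$ and $\hat\sigma_p(pw)=\sigma_p(pwq)$, and records $v$ if at least $\lfloor (n+m)/2\rfloor$ of the $n-1$ entries of the resulting vector equal $v$; otherwise it records NIL. The decision is the majority value of the recorded vector ($0$ on a tie). **GENERIC.** Given $\ell$, $M$, the positions of the processes, and a number $k$ (a bound on the number of squares of $\mathcal A$ that one fault square can overlap), put $t=kM$. The leaders run PSL on $P_L$ with $m=t$ (rounds $1,\dots,t+1$), decide, and broadcast their decision (round $t+2$). Every other process decides $v$ once it has received the decision $v$ from at least $2t+1$ leaders. **Theorem.** Algorithm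 GENERIC solves geoconsensus, and every correct process decides within $kM+2$ communication rounds, in each of the following cases. 1. The $F_i$ are $\ell\times\ell$ squares of arbitrary orientations and $|\mathcal A|\ge 22M$; here $k=7$, and always $f\le N-15M$. 2. The $F_i$ are axis-aligned $\ell\times\ell$ squares and $|\mathcal A|\ge 13M$; here $k=4$, and always $f\le N-9M$. 3. The $F_i$ are $\ell/\sqrt2\times\ell/\sqrt2$ squares of arbitrary orientations and $|\mathcal A|\ge 13M$; here $k=4$, and always $f\le N-9M$. So every such fault pattern, with $f\le N-15M$ (respectively $f\le N-9M$) Byzantine processes, is tolerated. -/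

import Mathlib

/-! ### Squares in the plane -/

/-- The closed square of side `a` with a corner at `c`, its sides from `c` pointing in the
directions `(cos θ, sin θ)` and `(-sin θ, cos θ)`. -/
def orientedSquare (c : ℝ × ℝ) (θ a : ℝ) : Set (ℝ × ℝ) :=
  {z | ∃ s ∈ Set.Icc (0 : ℝ) a, ∃ t ∈ Set.Icc (0 : ℝ) a,
    z.1 = c.1 + s * Real.cos θ - t * Real.sin θ ∧
    z.2 = c.2 + s * Real.sin θ + t * Real.cos θ}

/-- The closed axis-aligned square of side `a` with bottom left corner `c`. -/
def axisSquare (c : ℝ × ℝ) (a : ℝ) : Set (ℝ × ℝ) :=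
  Set.Icc c.1 (c.1 + a) ×ˢ Set.Icc c.2 (c.2 + a)

/-- `S` is a closed square of side `a`, in any position and orientation. -/
def IsSquareOfSide (a : ℝ) (S : Set (ℝ × ℝ)) : Prop :=
  ∃ (c : ℝ × ℝ) (θ : ℝ), S = orientedSquare c θ a

/-- `S` is a closed axis-aligned square of side `a`, in any position. -/
def IsAxisSquareOfSide (a : ℝ) (S : Set (ℝ × ℝ)) : Prop :=
  ∃ c : ℝ × ℝ, S = axisSquare c a

/-! ### The greedy square cover -/

/-- The one-dimensional greedy sweep with intervals of length `ℓ`: start the first interval at the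
least point of `S`, discard the points of `S` that this interval covers, and go on with the rest.
The result is the set of left ends of the intervals.  (For `0 ≤ ℓ` the least point is discarded
anyway; erasing it makes the recursion terminate for every `ℓ`.) -/
noncomputable def greedyStarts (ℓ : ℝ) (S : Finset ℝ) : Finset ℝ :=
  if h : S.Nonempty then
    insert (S.min' h)
      (greedyStarts ℓ ((S.erase (S.min' h)).filter fun x => S.min' h + ℓ < x))
  else ∅
termination_by S.card
decreasing_by
  exact lt_of_le_of_lt (Finset.card_filter_le _ _)
    (Finset.card_erase_lt_of_mem (S.min'_mem h))

section Cover

variable {α : Type*} [Fintype α]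

/-- The bottoms of the horizontal slabs of height `ℓ` that the sweep from below produces. -/
noncomputable def slabBottoms (ℓ : ℝ) (pos : α → ℝ × ℝ) : Finset ℝ :=
  greedyStarts ℓ (Finset.univ.image fun p => (pos p).2)

/-- The processes in the slab with bottom `b`. -/
noncomputable def slab (ℓ : ℝ) (pos : α → ℝ × ℝ) (b : ℝ) : Finset α :=
  Finset.univ.filter fun p => b ≤ (pos p).2 ∧ (pos p).2 ≤ b + ℓ

/-- The greedy cover of the processes by axis-aligned squares of side `ℓ`: every slab is
swept from left to right.  A square is recorded through its bottom left corner. -/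
noncomputable def squareCover (ℓ : ℝ) (pos : α → ℝ × ℝ) : Finset (ℝ × ℝ) :=
  (slabBottoms ℓ pos).biUnion fun b =>
    (greedyStarts ℓ ((slab ℓ pos b).image fun p => (pos p).1)).image fun a => (a, b)

/-- `p` is the leader of the square with bottom left corner `A`: among the processes covered by
that square it has the least `y`-coordinate and, among those, the least `x`-coordinate. -/
def IsLeaderOf (ℓ : ℝ) (pos : α → ℝ × ℝ) (A : ℝ × ℝ) (p : α) : Prop :=
  pos p ∈ axisSquare A ℓ ∧
    ∀ q, pos q ∈ axisSquare A ℓ →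
      (pos p).2 < (pos q).2 ∨ ((pos p).2 = (pos q).2 ∧ (pos p).1 ≤ (pos q).1)

open Classical in
/-- The leaders of all squares of the greedy cover. -/
noncomputable def leaders (ℓ : ℝ) (pos : α → ℝ × ℝ) : Finset α :=
  Finset.univ.filter fun p => ∃ A ∈ squareCover ℓ pos, IsLeaderOf ℓ pos A p

end Cover

/-! ### Synchronous protocols and Byzantine faults -/

/-- A deterministic synchronous message-passing protocol on a complete network of processes `α`
with message type `μ` and local states `σ`.  Rounds are numbered `0, 1, 2, …`. -/
structure Protocol (α μ σ : Type*) where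
  /-- the state of a process before round `0`, given its input -/
  start : α → Bool → σ
  /-- the message which a process sends in a round, in a given state, to a given process -/
  send : α → ℕ → σ → α → μ
  /-- the state after a round, given the state before it and the message from each process -/
  next : α → ℕ → σ → (α → μ) → σ
  /-- the decision, if one has been made -/
  output : σ → Option Bool

/-- A computation of the protocol `proto` in which the processes outside `B` are correct and those
in `B` are Byzantine: `state r p` is the state of `p` before round `r`, and `msg r p q` is what
`p` sends to `q` in round `r`.  Nothing is required of a faulty process; its messages are
arbitrary, but the receiver knows who sent them. -/
structure IsComputation {α μ σ : Type*} (proto : Protocol α μ σ) (B : Finset α) (input : α → Bool)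
    (state : ℕ → α → σ) (msg : ℕ → α → α → μ) : Prop where
  start_eq : ∀ p, p ∉ B → state 0 p = proto.start p (input p)
  send_eq : ∀ r p, p ∉ B → ∀ q, msg r p q = proto.send p r (state r p) q
  next_eq : ∀ r q, q ∉ B → state (r + 1) q = proto.next q r (state r q) fun p => msg r p q

/-- Binary consensus among the processes outside `B` in a computation with local states `state`:
decisions are irrevocable, and agreement, validity and termination hold, the latter after at most
`T` communication rounds. -/
structure ReachesConsensus {α μ σ : Type*} (proto : Protocol α μ σ) (B : Finset α)
    (input : α → Bool) (state : ℕ → α → σ) (T : ℕ) : Prop where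
  irrevocable : ∀ p, p ∉ B → ∀ r r' v, r ≤ r' →
    proto.output (state r p) = some v → proto.output (state r' p) = some v
  agreement : ∀ p, p ∉ B → ∀ q, q ∉ B → ∀ r r' v w,
    proto.output (state r p) = some v → proto.output (state r' q) = some w → v = w
  validity : ∀ v, (∀ p, p ∉ B → input p = v) →
    ∀ p, p ∉ B → ∃ r, proto.output (state r p) = some v
  termination : ∀ p, p ∉ B → ∃ v, proto.output (state T p) = some v

/-- Every process in `B` is covered by one of the fault areas `F i`. -/
def CoveredBy {α : Type*} {M : ℕ} (pos : α → ℝ × ℝ) (F : Fin M → Set (ℝ × ℝ))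
    (B : Finset α) : Prop :=
  ∀ p ∈ B, ∃ i, pos p ∈ F i

/-- The protocol solves geoconsensus within `T` rounds for the fault areas `F i`: every
computation in which only processes covered by fault areas are faulty reaches consensus. -/
def SolvesGeoconsensus {α μ σ : Type*} {M : ℕ} (proto : Protocol α μ σ) (pos : α → ℝ × ℝ)
    (F : Fin M → Set (ℝ × ℝ)) (T : ℕ) : Prop :=
  ∀ B : Finset α, CoveredBy pos F B →
    ∀ (input : α → Bool) (state : ℕ → α → σ) (msg : ℕ → α → α → μ),
      IsComputation proto B input state msg → ReachesConsensus proto B input state T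

/-! ### The algorithm of Pease, Shostak and Lamport -/

open Classical in
/-- The first of `true`, `false` with the property `P`, if there is one. -/
noncomputable def pick (P : Bool → Prop) : Option Bool :=
  if P true then some true else if P false then some false else none

/-- There is a set `Q ⊆ S` of more than `(|S| + m) / 2` processes such that everything heard about
the value of `q` through chains of at most `m` members of `Q` is `v`. -/
def Unanimous {α : Type*} (m : ℕ) (S : Finset α) (view : List α → Bool) (q : α) (v : Bool) :
    Prop :=
  ∃ Q ⊆ S, S.card + m < 2 * Q.card ∧
    ∀ w : List α, w.length ≤ m → (∀ x ∈ w, x ∈ Q) → view (w ++ [q]) = v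

open Classical in
/-- The entry for `q` of the interactive consistency vector computed by a process among the
processes `S`, at most `m` of which are faulty; `none` is the value NIL.  Here `view w`, for
`w = [p₁, p₂, …, pᵣ]`, is what `p₁` told this process that `p₂` told `p₁` … that `pᵣ` said its
own value is.  If there is no unanimity on the value of `q`, the algorithm is applied to the other
processes and `m - 1`, each of them taking the value it got from `q` as its own, and a value is
recorded if at least `⌊(|S| + m) / 2⌋` entries of the resulting vector agree on it. -/
noncomputable def pslEntry {α : Type*} :
    ℕ → Finset α → (List α → Bool) → α → Option Bool
  | 0, S, view, q => pick (Unanimous 0 S view q)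
  | m + 1, S, view, q =>
    (pick (Unanimous (m + 1) S view q)).orElse fun _ =>
      pick fun v =>
        (S.card + (m + 1)) / 2 ≤
          ((S.erase q).filter fun r =>
            pslEntry m (S.erase q) (fun w => view (w ++ [q])) r = some v).card

open Classical in
/-- The decision: the majority value of the interactive consistency vector (`false` on a tie). -/
noncomputable def pslDecision {α : Type*} (m : ℕ) (S : Finset α) (view : List α → Bool) : Bool :=
  decide ((S.filter fun q => pslEntry m S view q = some false).card <
    (S.filter fun q => pslEntry m S view q = some true).card)

/-! ### The algorithm GENERIC -/

/-- Messages: nothing, a report of what the sender has heard, or a decision. -/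
inductive GMessage (α : Type*) where
  | silent : GMessage α
  | report (view : List α → Bool) : GMessage α
  | decided (v : Bool) : GMessage α

/-- What a message says about the chain `w`; a missing report is read as `false`. -/
def GMessage.read {α : Type*} : GMessage α → List α → Bool
  | .report view, w => view w
  | _, _ => false

/-- Local states: what has been heard along chains of leaders (`view []` is the own input), the
leaders from which the decision `v` has been received, and the own decision. -/
structure GState (α : Type*) where
  view : List α → Bool
  heard : Bool → Finset α
  decision : Option Bool

open Classical in
/-- GENERIC for the processes at the places `pos`, cover squares of side `ℓ`, `M` fault areas, and
`k` a bound on the number of cover squares that a fault area overlaps, so that at most `t = k * M` leaders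
are faulty.  In rounds `0, …, t` the leaders exchange reports and, after round `t`, decide by the
algorithm of Pease, Shostak and Lamport; in round `t + 1` they broadcast their decision.  The other
processes wait for the same decision from at least `2 * t + 1` leaders and adopt it. -/
noncomputable def generic {α : Type*} [Fintype α] (ℓ : ℝ) (pos : α → ℝ × ℝ) (k M : ℕ) :
    Protocol α (GMessage α) (GState α) where
  start _ v :=
    { view := fun w => if w = [] then v else false
      heard := fun _ => ∅
      decision := none }
  send p r s q :=
    if p ∈ leaders ℓ pos then
      if r ≤ k * M then
        if q ∈ leaders ℓ pos then .report s.view else .silent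
      else if r = k * M + 1 then
        match s.decision with
        | some v => .decided v
        | none => .silent
      else .silent
    else .silent
  next p r s inbox :=
    if p ∈ leaders ℓ pos then
      let view' : List α → Bool := fun w =>
        match w with
        | [] => s.view []
        | q :: w' =>
          if r ≤ k * M ∧ q ∈ leaders ℓ pos ∧ w'.length = r then (inbox q).read w'
          else s.view (q :: w')
      { view := view'
        heard := s.heard
        decision :=
          if r = k * M then some (pslDecision (k * M) (leaders ℓ pos) view') else s.decision }
    else
      let heard' : Bool → Finset α := fun v =>
        s.heard v ∪ (leaders ℓ pos).filter fun q => inbox q = .decided v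
      { view := s.view
        heard := heard'
        decision := s.decision.orElse fun _ => pick fun v => 2 * (k * M) + 1 ≤ (heard' v).card }
  output s := s.decision

/-! A fault square overlaps few squares of the greedy cover. The left ends in a slab, and the
bottoms of the slabs, are more than `ℓ` apart (`gapsExceed_greedyStarts`), so a set of extent at
most `k * ℓ` in some direction meets at most `k + 1` of the corresponding intervals
(`GapsExceed.card_le`). Axis-aligned squares of side `ℓ` and squares of side `ℓ / √2` have extent
at most `ℓ` in both directions, which gives at most `2 * 2` cover squares. A square of side `ℓ` in
any orientation has extent at most `√2 * ℓ < 2 * ℓ`, which gives at most three slabs and three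
squares in each. If it does reach three slabs, then it overlaps at most two squares in the lowest
and in the highest one (`card_overlappedRow_le_two`): otherwise it would contain a triangle with
a horizontal and a vertical extent that make its area exceed `ℓ ^ 2 / 2`, half the area of the
square, or two points further apart than its diagonal. The total is at most `2 + 3 + 2 = 7`.

Cover squares are disjoint and have one leader each, so at most `t = k * M` leaders are faulty
(`card_faulty_leaders_le`), while there are more than `3 * t` of them.

The algorithm of Pease, Shostak and Lamport therefore makes the correct leaders agree
(`pslEntry_agree`), by induction on the depth `m`. For a correct `q`, the correct processes
witness unanimity on its value. For a faulty `q` the recursive call is made with one fault less.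
If one process finds unanimity on `v` through a set `Q`, then the recursive call of that process
has the entry `v` for all of `Q` except `q`, again by unanimity; the induction hypothesis carries
this over to all correct processes, whose count then reaches the threshold for `v` and cannot
reach it for the other value.

A process that is not a leader hears the common decision from all correct leaders, at least
`2 * t + 1`, and any other value from faulty ones only, at most `t`. -/

/-! ### Greedy sweeps -/

/-- Any two points of `S` are more than `ℓ` apart. -/
def GapsExceed (ℓ : ℝ) (S : Finset ℝ) : Prop :=
  ∀ x ∈ S, ∀ y ∈ S, x < y → x + ℓ < y

theorem GapsExceed.mono {ℓ : ℝ} {S T : Finset ℝ} (hT : GapsExceed ℓ T) (h : S ⊆ T) :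
    GapsExceed ℓ S :=
  fun x hx y hy => hT x (h hx) y (h hy)

theorem greedyStarts_subset (ℓ : ℝ) (S : Finset ℝ) : greedyStarts ℓ S ⊆ S := by
  induction hn : S.card using Nat.strong_induction_on generalizing S with
  | _ n ih =>
    rw [greedyStarts]
    split_ifs with h
    · refine Finset.insert_subset (S.min'_mem h) ?_
      have hlt := lt_of_le_of_lt
        (Finset.card_filter_le (S.erase (S.min' h)) fun x => S.min' h + ℓ < x)
        (Finset.card_erase_lt_of_mem (S.min'_mem h))
      exact (ih _ (hn ▸ hlt) _ rfl).trans
        ((Finset.filter_subset _ _).trans (Finset.erase_subset _ _))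
    · exact Finset.empty_subset _

theorem gapsExceed_greedyStarts (ℓ : ℝ) (S : Finset ℝ) : GapsExceed ℓ (greedyStarts ℓ S) := by
  induction hn : S.card using Nat.strong_induction_on generalizing S with
  | _ n ih =>
    rw [greedyStarts]
    split_ifs with h
    · have hlt := lt_of_le_of_lt
        (Finset.card_filter_le (S.erase (S.min' h)) fun x => S.min' h + ℓ < x)
        (Finset.card_erase_lt_of_mem (S.min'_mem h))
      have hrest : ∀ x ∈ greedyStarts ℓ ((S.erase (S.min' h)).filter fun x => S.min' h + ℓ < x),
          x ∈ S.erase (S.min' h) ∧ S.min' h + ℓ < x := fun x hx =>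
        Finset.mem_filter.1 (greedyStarts_subset _ _ hx)
      intro x hx y hy hxy
      rw [Finset.mem_insert] at hx hy
      rcases hx with rfl | hx <;> rcases hy with rfl | hy
      · exact absurd hxy (lt_irrefl _)
      · exact (hrest y hy).2
      · exact absurd (S.min'_le x (Finset.mem_of_mem_erase (hrest x hx).1)) (not_le.2 hxy)
      · exact ih _ (hn ▸ hlt) _ rfl x hx y hy hxy
    · simp [GapsExceed]

theorem GapsExceed.exists_far {ℓ : ℝ} {n : ℕ} {S : Finset ℝ} (hS : GapsExceed ℓ S)
    (hn : n + 2 ≤ S.card) : ∃ x ∈ S, ∃ z ∈ S, x + (n + 1) * ℓ < z := by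
  induction n generalizing S with
  | zero =>
    obtain ⟨x, hx, y, hy, hxy⟩ := Finset.one_lt_card.1 (show 1 < S.card by omega)
    rcases lt_or_gt_of_ne hxy with h | h
    · exact ⟨x, hx, y, hy, by simpa using hS x hx y hy h⟩
    · exact ⟨y, hy, x, hx, by simpa using hS y hy x hx h⟩
  | succ n ih =>
    have hne : S.Nonempty := Finset.card_pos.1 (by omega)
    have hcard := Finset.card_erase_of_mem (S.max'_mem hne)
    obtain ⟨x, hx, z, hz, h⟩ :=
      ih (hS.mono (Finset.erase_subset (S.max' hne) S)) (by omega)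
    have hz' := Finset.mem_of_mem_erase hz
    have := hS z hz' _ (S.max'_mem hne)
      (lt_of_le_of_ne (S.le_max' z hz') (Finset.ne_of_mem_erase hz))
    refine ⟨x, Finset.mem_of_mem_erase hx, _, S.max'_mem hne, ?_⟩
    push_cast
    linarith

/-- If every interval `[x, x + ℓ]` with `x ∈ S` meets a set of extent at most `k * ℓ`, then there
are at most `k + 1` of them. -/
theorem GapsExceed.card_le {ℓ : ℝ} {S : Finset ℝ} (hS : GapsExceed ℓ S) (k : ℕ) (U : Set ℝ)
    (hU : ∀ u ∈ U, ∀ v ∈ U, u - v ≤ k * ℓ) (hmeet : ∀ x ∈ S, ∃ u ∈ U, x ≤ u ∧ u ≤ x + ℓ) :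
    S.card ≤ k + 1 := by
  by_contra! h
  obtain ⟨x, hx, z, hz, hxz⟩ := hS.exists_far h
  obtain ⟨u, hu, -, hux⟩ := hmeet x hx
  obtain ⟨v, hv, hvz, -⟩ := hmeet z hz
  linarith [hU v hv u hu]

/-! ### Squares in arbitrary position -/

theorem orientedSquare_dist_sq_le {c : ℝ × ℝ} {θ a : ℝ} {z w : ℝ × ℝ}
    (hz : z ∈ orientedSquare c θ a) (hw : w ∈ orientedSquare c θ a) :
    (z.1 - w.1) ^ 2 + (z.2 - w.2) ^ 2 ≤ 2 * a ^ 2 := by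
  obtain ⟨s, hs, t, ht, h1, h2⟩ := hz
  obtain ⟨s', hs', t', ht', h1', h2'⟩ := hw
  have e : (z.1 - w.1) ^ 2 + (z.2 - w.2) ^ 2 =
      ((s - s') ^ 2 + (t - t') ^ 2) * (Real.sin θ ^ 2 + Real.cos θ ^ 2) := by
    rw [h1, h2, h1', h2']; ring
  rw [e, Real.sin_sq_add_cos_sq, mul_one]
  have hs2 : (s - s') ^ 2 ≤ a ^ 2 :=
    sq_le_sq' (by linarith [hs.1, hs'.2]) (by linarith [hs.2, hs'.1])
  have ht2 : (t - t') ^ 2 ≤ a ^ 2 :=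
    sq_le_sq' (by linarith [ht.1, ht'.2]) (by linarith [ht.2, ht'.1])
  linarith

/-- Twice the signed area of a triangle in the square `[0, a] ^ 2` is at most `a ^ 2`. -/
theorem triangle_area_le {a s₁ s₂ s₃ t₁ t₂ t₃ : ℝ} (hs₁ : s₁ ∈ Set.Icc 0 a)
    (hs₂ : s₂ ∈ Set.Icc 0 a) (hs₃ : s₃ ∈ Set.Icc 0 a) (ht₁ : t₁ ∈ Set.Icc 0 a)
    (ht₂ : t₂ ∈ Set.Icc 0 a) (ht₃ : t₃ ∈ Set.Icc 0 a) :
    s₁ * (t₂ - t₃) + s₂ * (t₃ - t₁) + s₃ * (t₁ - t₂) ≤ a ^ 2 := by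
  have ha : 0 ≤ a := hs₁.1.trans hs₁.2
  have key : ∀ s ∈ Set.Icc 0 a, ∀ d : ℝ, s * d ≤ a * max d 0 := fun s hs d =>
    (mul_le_mul_of_nonneg_left (le_max_left d 0) hs.1).trans
      (mul_le_mul_of_nonneg_right hs.2 (le_max_right d 0))
  -- the positive parts of the cyclic differences add up to the spread of the `tᵢ`
  have hsum : max (t₂ - t₃) 0 + max (t₃ - t₁) 0 + max (t₁ - t₂) 0 ≤ a := by
    obtain ⟨h1, h1'⟩ := ht₁
    obtain ⟨h2, h2'⟩ := ht₂
    obtain ⟨h3, h3'⟩ := ht₃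
    rcases max_cases (t₂ - t₃) 0 with h | h <;> rcases max_cases (t₃ - t₁) 0 with h' | h' <;>
      rcases max_cases (t₁ - t₂) 0 with h'' | h'' <;> linarith
  have := mul_le_mul_of_nonneg_left hsum ha
  linarith [key s₁ hs₁ (t₂ - t₃), key s₂ hs₂ (t₃ - t₁), key s₃ hs₃ (t₁ - t₂)]

theorem orientedSquare_cross_le {c : ℝ × ℝ} {θ a : ℝ} {P Q R : ℝ × ℝ}
    (hP : P ∈ orientedSquare c θ a) (hQ : Q ∈ orientedSquare c θ a)
    (hR : R ∈ orientedSquare c θ a) :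
    (Q.1 - P.1) * (R.2 - P.2) - (Q.2 - P.2) * (R.1 - P.1) ≤ a ^ 2 := by
  obtain ⟨s₁, hs₁, t₁, ht₁, h1, h1'⟩ := hP
  obtain ⟨s₂, hs₂, t₂, ht₂, h2, h2'⟩ := hQ
  obtain ⟨s₃, hs₃, t₃, ht₃, h3, h3'⟩ := hR
  have e : (Q.1 - P.1) * (R.2 - P.2) - (Q.2 - P.2) * (R.1 - P.1) =
      (s₁ * (t₂ - t₃) + s₂ * (t₃ - t₁) + s₃ * (t₁ - t₂)) *
        (Real.sin θ ^ 2 + Real.cos θ ^ 2) := by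
    rw [h1, h2, h3, h1', h2', h3']; ring
  rw [e, Real.sin_sq_add_cos_sq, mul_one]
  exact triangle_area_le hs₁ hs₂ hs₃ ht₁ ht₂ ht₃

/-- A square of side `ℓ` cannot contain points `P`, `Q` more than `ℓ` apart horizontally together
with a point `R` that is more than `ℓ` below both: if `R` is between them horizontally, then the
triangle `PQR` is too large; otherwise `R` is too far from one of them. -/
theorem orientedSquare_not_wide_above {c : ℝ × ℝ} {θ ℓ : ℝ} (hℓ : 0 < ℓ) {P Q R : ℝ × ℝ}
    (hP : P ∈ orientedSquare c θ ℓ) (hQ : Q ∈ orientedSquare c θ ℓ)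
    (hR : R ∈ orientedSquare c θ ℓ) (hPQ : P.1 + ℓ < Q.1)
    (hRP : R.2 + ℓ < P.2) (hRQ : R.2 + ℓ < Q.2) : False := by
  rcases lt_or_ge R.1 P.1 with h | h
  · have := orientedSquare_dist_sq_le hQ hR
    nlinarith
  · rcases lt_or_ge Q.1 R.1 with h' | h'
    · have := orientedSquare_dist_sq_le hR hP
      nlinarith
    · have := orientedSquare_cross_le hP hR hQ
      nlinarith [mul_nonneg (sub_nonneg.2 h) (sub_nonneg.2 hRQ.le),
        mul_nonneg (sub_nonneg.2 h') (sub_nonneg.2 hRP.le)]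

theorem orientedSquare_not_wide_below {c : ℝ × ℝ} {θ ℓ : ℝ} (hℓ : 0 < ℓ) {P Q R : ℝ × ℝ}
    (hP : P ∈ orientedSquare c θ ℓ) (hQ : Q ∈ orientedSquare c θ ℓ)
    (hR : R ∈ orientedSquare c θ ℓ) (hPQ : P.1 + ℓ < Q.1)
    (hPR : P.2 + ℓ < R.2) (hQR : Q.2 + ℓ < R.2) : False := by
  rcases lt_or_ge R.1 P.1 with h | h
  · have := orientedSquare_dist_sq_le hQ hR
    nlinarith
  · rcases lt_or_ge Q.1 R.1 with h' | h'
    · have := orientedSquare_dist_sq_le hR hP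
      nlinarith
    · have := orientedSquare_cross_le hP hQ hR
      nlinarith [mul_nonneg (sub_nonneg.2 h) (sub_nonneg.2 hQR.le),
        mul_nonneg (sub_nonneg.2 h') (sub_nonneg.2 hPR.le)]

/-! ### Cover squares that a fault area overlaps -/

section Overlap

variable {α : Type*} [Fintype α]

theorem mem_squareCover {ℓ : ℝ} {pos : α → ℝ × ℝ} {A : ℝ × ℝ} :
    A ∈ squareCover ℓ pos ↔ A.2 ∈ slabBottoms ℓ pos ∧
      A.1 ∈ greedyStarts ℓ ((slab ℓ pos A.2).image fun p => (pos p).1) := by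
  obtain ⟨a, b⟩ := A
  simp only [squareCover, Finset.mem_biUnion, Finset.mem_image, Prod.mk.injEq]
  constructor
  · rintro ⟨b, hb, a, ha, rfl, rfl⟩
    exact ⟨hb, ha⟩
  · rintro ⟨hb, ha⟩
    exact ⟨b, hb, a, ha, rfl, rfl⟩

theorem squareCover_disjoint {ℓ : ℝ} {pos : α → ℝ × ℝ} {A A' z : ℝ × ℝ}
    (hA : A ∈ squareCover ℓ pos) (hA' : A' ∈ squareCover ℓ pos)
    (hz : z ∈ axisSquare A ℓ) (hz' : z ∈ axisSquare A' ℓ) : A = A' := by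
  obtain ⟨a, b⟩ := A
  obtain ⟨a', b'⟩ := A'
  rw [mem_squareCover] at hA hA'
  obtain ⟨⟨h1, h2⟩, h3, h4⟩ := hz
  obtain ⟨⟨h1', h2'⟩, h3', h4'⟩ := hz'
  dsimp only at *
  have hb : b = b' := by
    rcases lt_trichotomy b b' with h | h | h
    · linarith [gapsExceed_greedyStarts _ _ _ hA.1 _ hA'.1 h]
    · exact h
    · linarith [gapsExceed_greedyStarts _ _ _ hA'.1 _ hA.1 h]
  subst hb
  rcases lt_trichotomy a a' with h | h | h
  · linarith [gapsExceed_greedyStarts _ _ _ hA.2 _ hA'.2 h]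
  · rw [h]
  · linarith [gapsExceed_greedyStarts _ _ _ hA'.2 _ hA.2 h]

theorem exists_mem_of_mem_squareCover {ℓ : ℝ} (hℓ : 0 ≤ ℓ) {pos : α → ℝ × ℝ} {A : ℝ × ℝ}
    (hA : A ∈ squareCover ℓ pos) : ∃ p, pos p ∈ axisSquare A ℓ := by
  obtain ⟨p, hp, hpA⟩ := Finset.mem_image.1 (greedyStarts_subset _ _ (mem_squareCover.1 hA).2)
  have hp' := (Finset.mem_filter.1 hp).2
  exact ⟨p, ⟨hpA.ge, by linarith⟩, hp'.1, hp'.2⟩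

open Classical in
/-- The squares of the greedy cover that the set `F` overlaps. -/
noncomputable def overlapped (ℓ : ℝ) (pos : α → ℝ × ℝ) (F : Set (ℝ × ℝ)) : Finset (ℝ × ℝ) :=
  (squareCover ℓ pos).filter fun A => (axisSquare A ℓ ∩ F).Nonempty

open Classical in
/-- The bottoms of the slabs with a square that `F` overlaps. -/
noncomputable def overlappedBottoms (ℓ : ℝ) (pos : α → ℝ × ℝ) (F : Set (ℝ × ℝ)) : Finset ℝ :=
  (overlapped ℓ pos F).image Prod.snd

open Classical in
/-- The left ends of the squares with bottom `b` that `F` overlaps. -/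
noncomputable def overlappedRow (ℓ : ℝ) (pos : α → ℝ × ℝ) (F : Set (ℝ × ℝ)) (b : ℝ) : Finset ℝ :=
  ((overlapped ℓ pos F).filter fun A => A.2 = b).image Prod.fst

variable {ℓ : ℝ} {pos : α → ℝ × ℝ} {F : Set (ℝ × ℝ)}

theorem card_overlapped_eq_sum :
    (overlapped ℓ pos F).card =
      ∑ b ∈ overlappedBottoms ℓ pos F, (overlappedRow ℓ pos F b).card := by
  classical
  have h : ∀ b, (overlappedRow ℓ pos F b).card =
      ((overlapped ℓ pos F).filter fun A => A.2 = b).card := by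
    intro b
    rw [overlappedRow]
    convert Finset.card_image_of_injOn ?_
    intro A hA A' hA' hAA'
    simp only [Finset.coe_filter, Set.mem_ofPred_eq] at hA hA'
    exact Prod.ext hAA' (hA.2.trans hA'.2.symm)
  simp only [h]
  rw [overlappedBottoms]
  convert Finset.card_eq_sum_card_image Prod.snd (overlapped ℓ pos F)

theorem mem_overlapped {A : ℝ × ℝ} :
    A ∈ overlapped ℓ pos F ↔ A ∈ squareCover ℓ pos ∧ (axisSquare A ℓ ∩ F).Nonempty := by
  simp [overlapped]

theorem mem_overlappedRow {a b : ℝ} :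
    a ∈ overlappedRow ℓ pos F b ↔ (a, b) ∈ overlapped ℓ pos F := by
  simp [overlappedRow]

theorem exists_of_mem_overlappedBottoms {b : ℝ} (hb : b ∈ overlappedBottoms ℓ pos F) :
    ∃ z ∈ F, b ≤ z.2 ∧ z.2 ≤ b + ℓ := by
  obtain ⟨A, hA, rfl⟩ := Finset.mem_image.1 hb
  obtain ⟨z, hzA, hzF⟩ := (mem_overlapped.1 hA).2
  exact ⟨z, hzF, hzA.2⟩

theorem exists_of_mem_overlappedRow {a b : ℝ} (ha : a ∈ overlappedRow ℓ pos F b) :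
    ∃ z ∈ F, (a ≤ z.1 ∧ z.1 ≤ a + ℓ) ∧ b ≤ z.2 ∧ z.2 ≤ b + ℓ := by
  obtain ⟨z, hzA, hzF⟩ := (mem_overlapped.1 (mem_overlappedRow.1 ha)).2
  exact ⟨z, hzF, hzA⟩

theorem gapsExceed_overlappedBottoms : GapsExceed ℓ (overlappedBottoms ℓ pos F) := by
  refine (gapsExceed_greedyStarts ℓ (Finset.univ.image fun p => (pos p).2)).mono ?_
  intro b hb
  obtain ⟨A, hA, rfl⟩ := Finset.mem_image.1 hb
  exact (mem_squareCover.1 (mem_overlapped.1 hA).1).1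

theorem gapsExceed_overlappedRow (b : ℝ) : GapsExceed ℓ (overlappedRow ℓ pos F b) := by
  refine (gapsExceed_greedyStarts ℓ ((slab ℓ pos b).image fun p => (pos p).1)).mono ?_
  intro a ha
  exact (mem_squareCover.1 (mem_overlapped.1 (mem_overlappedRow.1 ha)).1).2

theorem card_overlappedBottoms_le (k : ℕ) (hF : ∀ z ∈ F, ∀ w ∈ F, z.2 - w.2 ≤ k * ℓ) :
    (overlappedBottoms ℓ pos F).card ≤ k + 1 := by
  refine gapsExceed_overlappedBottoms.card_le k (Prod.snd '' F) ?_ fun b hb => ?_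
  · rintro _ ⟨z, hz, rfl⟩ _ ⟨w, hw, rfl⟩
    exact hF z hz w hw
  · obtain ⟨z, hz, h⟩ := exists_of_mem_overlappedBottoms hb
    exact ⟨_, ⟨z, hz, rfl⟩, h⟩

theorem card_overlappedRow_le (k : ℕ) (hF : ∀ z ∈ F, ∀ w ∈ F, z.1 - w.1 ≤ k * ℓ) (b : ℝ) :
    (overlappedRow ℓ pos F b).card ≤ k + 1 := by
  refine (gapsExceed_overlappedRow b).card_le k (Prod.fst '' F) ?_ fun a ha => ?_
  · rintro _ ⟨z, hz, rfl⟩ _ ⟨w, hw, rfl⟩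
    exact hF z hz w hw
  · obtain ⟨z, hz, h, -⟩ := exists_of_mem_overlappedRow ha
    exact ⟨_, ⟨z, hz, rfl⟩, h⟩

theorem card_overlapped_le_four (h₁ : ∀ z ∈ F, ∀ w ∈ F, z.1 - w.1 ≤ ℓ)
    (h₂ : ∀ z ∈ F, ∀ w ∈ F, z.2 - w.2 ≤ ℓ) : (overlapped ℓ pos F).card ≤ 4 := by
  rw [card_overlapped_eq_sum]
  calc ∑ b ∈ overlappedBottoms ℓ pos F, (overlappedRow ℓ pos F b).card
      ≤ ∑ _b ∈ overlappedBottoms ℓ pos F, 2 :=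
        Finset.sum_le_sum fun b _ => card_overlappedRow_le 1 (by simpa using h₁) b
    _ = (overlappedBottoms ℓ pos F).card * 2 := by simp
    _ ≤ 4 := by have := card_overlappedBottoms_le (pos := pos) 1 (by simpa using h₂); omega

theorem card_overlapped_le_four_of_axisSquare (hF : IsAxisSquareOfSide ℓ F) :
    (overlapped ℓ pos F).card ≤ 4 := by
  obtain ⟨c, rfl⟩ := hF
  refine card_overlapped_le_four ?_ ?_
  · rintro z ⟨hz, -⟩ w ⟨hw, -⟩
    linarith [hz.2, hw.1]
  · rintro z ⟨-, hz⟩ w ⟨-, hw⟩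
    linarith [hz.2, hw.1]

/-- A square of side `ℓ / √2` has diameter `ℓ`. -/
theorem card_overlapped_le_four_of_small_square (hℓ : 0 < ℓ)
    (hF : IsSquareOfSide (ℓ / Real.sqrt 2) F) : (overlapped ℓ pos F).card ≤ 4 := by
  obtain ⟨c, θ, rfl⟩ := hF
  have hside : 2 * (ℓ / Real.sqrt 2) ^ 2 = ℓ ^ 2 := by
    rw [div_pow, Real.sq_sqrt zero_le_two]; ring
  refine card_overlapped_le_four ?_ ?_ <;> intro z hz w hw <;>
    have := orientedSquare_dist_sq_le hz hw <;> refine abs_le_of_sq_le_sq' ?_ hℓ.le |>.2 <;>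
    nlinarith [sq_nonneg (z.1 - w.1), sq_nonneg (z.2 - w.2)]

/-- A square of side `ℓ` that reaches a slab beginning more than `2 * ℓ` above or below the slab
with bottom `b` overlaps at most two cover squares with bottom `b`. -/
theorem card_overlappedRow_le_two {c : ℝ × ℝ} {θ b b' : ℝ} (hℓ : 0 < ℓ)
    (hb' : b' ∈ overlappedBottoms ℓ pos (orientedSquare c θ ℓ))
    (h : b + 2 * ℓ < b' ∨ b' + 2 * ℓ < b) :
    (overlappedRow ℓ pos (orientedSquare c θ ℓ) b).card ≤ 2 := by
  by_contra! hcard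
  obtain ⟨x, hx, y, hy, hxy⟩ := (gapsExceed_overlappedRow b).exists_far (n := 1) hcard
  obtain ⟨P, hP, ⟨-, hPx⟩, hPb⟩ := exists_of_mem_overlappedRow hx
  obtain ⟨Q, hQ, ⟨hQy, -⟩, hQb⟩ := exists_of_mem_overlappedRow hy
  obtain ⟨R, hR, hRb⟩ := exists_of_mem_overlappedBottoms hb'
  push_cast at hxy
  rcases h with h | h
  · exact orientedSquare_not_wide_below hℓ hP hQ hR (by linarith) (by linarith) (by linarith)
  · exact orientedSquare_not_wide_above hℓ hP hQ hR (by linarith) (by linarith) (by linarith)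

theorem card_overlapped_le_seven (hℓ : 0 < ℓ) (hF : IsSquareOfSide ℓ F) :
    (overlapped ℓ pos F).card ≤ 7 := by
  classical
  obtain ⟨c, θ, rfl⟩ := hF
  have hrow : ∀ b, (overlappedRow ℓ pos (orientedSquare c θ ℓ) b).card ≤ 3 := by
    refine card_overlappedRow_le 2 fun z hz w hw => ?_
    have := orientedSquare_dist_sq_le hz hw
    push_cast
    exact (abs_le_of_sq_le_sq' (by nlinarith [sq_nonneg (z.2 - w.2)]) (by linarith)).2
  have hbot : (overlappedBottoms ℓ pos (orientedSquare c θ ℓ)).card ≤ 3 := by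
    refine card_overlappedBottoms_le 2 fun z hz w hw => ?_
    have := orientedSquare_dist_sq_le hz hw
    push_cast
    exact (abs_le_of_sq_le_sq' (by nlinarith [sq_nonneg (z.1 - w.1)]) (by linarith)).2
  rw [card_overlapped_eq_sum]
  generalize hS : overlappedBottoms ℓ pos (orientedSquare c θ ℓ) = S at hbot ⊢
  have hsum : ∀ T : Finset ℝ,
      ∑ b ∈ T, (overlappedRow ℓ pos (orientedSquare c θ ℓ) b).card ≤ T.card * 3 := fun T => by
    simpa using Finset.sum_le_sum fun b (_ : b ∈ T) => hrow b
  rcases Nat.lt_or_ge S.card 3 with h | h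
  · have := hsum S
    omega
  · -- three overlapped slabs: the outer two contribute at most two squares each
    obtain ⟨x, hx, z, hz, hxz⟩ :=
      (hS ▸ gapsExceed_overlappedBottoms : GapsExceed ℓ S).exists_far (n := 1) h
    push_cast at hxz
    have hne : z ≠ x := by rintro rfl; linarith
    have hzS : z ∈ S.erase x := Finset.mem_erase.2 ⟨hne, hz⟩
    have h1 := card_overlappedRow_le_two (b := x) hℓ (hS ▸ hz) (Or.inl (by linarith))
    have h2 := card_overlappedRow_le_two (b := z) hℓ (hS ▸ hx) (Or.inr (by linarith))
    rw [← Finset.add_sum_erase _ _ hx, ← Finset.add_sum_erase _ _ hzS]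
    have h3 := hsum ((S.erase x).erase z)
    rw [Finset.card_erase_of_mem hzS, Finset.card_erase_of_mem hx] at h3
    omega

end Overlap

/-! ### Leaders -/

theorem IsLeaderOf.unique {α : Type*} {ℓ : ℝ} {pos : α → ℝ × ℝ} (hpos : Function.Injective pos)
    {A : ℝ × ℝ} {p q : α} (hp : IsLeaderOf ℓ pos A p) (hq : IsLeaderOf ℓ pos A q) : p = q := by
  apply hpos
  rcases hp.2 q hq.1 with h | ⟨h, h'⟩ <;> rcases hq.2 p hp.1 with k | ⟨k, k'⟩
  · linarith
  · linarith
  · linarith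
  · exact Prod.ext (le_antisymm h' k') h

section Leaders

variable {α : Type*} [Fintype α]

theorem exists_isLeaderOf {ℓ : ℝ} (hℓ : 0 ≤ ℓ) {pos : α → ℝ × ℝ} {A : ℝ × ℝ}
    (hA : A ∈ squareCover ℓ pos) : ∃ p, IsLeaderOf ℓ pos A p := by
  classical
  obtain ⟨p₀, hp₀⟩ := exists_mem_of_mem_squareCover hℓ hA
  obtain ⟨p, hp, hmin⟩ := Finset.exists_min_image
    (Finset.univ.filter fun p => pos p ∈ axisSquare A ℓ)
    (fun p => toLex ((pos p).2, (pos p).1)) ⟨p₀, by simpa using hp₀⟩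
  simp only [Finset.mem_filter, Finset.mem_univ, true_and] at hp hmin
  exact ⟨p, hp, fun q hq => by simpa [Prod.Lex.toLex_le_toLex] using hmin q hq⟩

theorem card_squareCover_le_card_leaders {ℓ : ℝ} (hℓ : 0 ≤ ℓ) (pos : α → ℝ × ℝ) :
    (squareCover ℓ pos).card ≤ (leaders ℓ pos).card := by
  classical
  rcases isEmpty_or_nonempty α with _ | _
  · rw [Finset.eq_empty_of_forall_notMem fun A hA =>
      isEmptyElim (exists_isLeaderOf hℓ (pos := pos) hA).choose]
    exact Nat.zero_le _
  choose! g hg using fun A (hA : A ∈ squareCover ℓ pos) => exists_isLeaderOf hℓ hA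
  refine Finset.card_le_card_of_injOn g (fun A hA => ?_) fun A hA A' hA' h => ?_
  · exact Finset.mem_filter.2 ⟨Finset.mem_univ _, A, hA, hg A hA⟩
  · exact squareCover_disjoint hA hA' (hg A hA).1 (h ▸ (hg A' hA').1)

open Classical in
theorem card_faulty_leaders_le {ℓ : ℝ} {pos : α → ℝ × ℝ} (hpos : Function.Injective pos)
    {M k : ℕ} {F : Fin M → Set (ℝ × ℝ)} (hF : ∀ i, (overlapped ℓ pos (F i)).card ≤ k)
    {B : Finset α} (hB : CoveredBy pos F B) :
    ((leaders ℓ pos).filter (· ∈ B)).card ≤ k * M := by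
  have hsq : ∀ p ∈ leaders ℓ pos, ∃ A ∈ squareCover ℓ pos, IsLeaderOf ℓ pos A p := fun p hp =>
    (Finset.mem_filter.1 hp).2
  choose! g hg hg' using hsq
  calc ((leaders ℓ pos).filter (· ∈ B)).card
      ≤ (Finset.univ.biUnion fun i => overlapped ℓ pos (F i)).card := by
        refine Finset.card_le_card_of_injOn g (fun p hp => ?_) fun p hp q hq h => ?_
        · obtain ⟨hpL, hpB⟩ := Finset.mem_filter.1 hp
          obtain ⟨i, hi⟩ := hB p hpB
          exact Finset.mem_biUnion.2 ⟨i, Finset.mem_univ _,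
            mem_overlapped.2 ⟨hg p hpL, _, (hg' p hpL).1, hi⟩⟩
        · exact (hg' p (Finset.mem_filter.1 hp).1).unique hpos
            (h ▸ hg' q (Finset.mem_filter.1 hq).1)
    _ ≤ ∑ i, (overlapped ℓ pos (F i)).card := Finset.card_biUnion_le
    _ ≤ ∑ _i : Fin M, k := Finset.sum_le_sum fun i _ => hF i
    _ = k * M := by simp [mul_comm]

end Leaders

/-! ### Correctness of the algorithm of Pease, Shostak and Lamport -/

theorem pick_eq_some {P : Bool → Prop} {v : Bool} (hv : P v) (huniq : ∀ w, P w → w = v) :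
    pick P = some v := by
  unfold pick
  cases v
  · rw [if_neg fun h => absurd (huniq _ h) (by simp), if_pos hv]
  · rw [if_pos hv]

theorem of_pick_eq_some {P : Bool → Prop} {v : Bool} (h : pick P = some v) : P v := by
  unfold pick at h
  split_ifs at h with h₁ h₂ <;> simp only [Option.some.injEq] at h <;> subst h <;> assumption

theorem pick_eq_none {P : Bool → Prop} (h : pick P = none) (v : Bool) : ¬ P v := by
  unfold pick at h
  split_ifs at h with h₁ h₂
  cases v <;> assumption

section PSL

variable {α : Type*}

open Classical in
theorem card_faulty_add_card_correct (S B : Finset α) :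
    (S.filter (· ∈ B)).card + (S.filter (· ∉ B)).card = S.card := by
  convert Finset.card_filter_add_card_filter_not (s := S) fun p => p ∈ B

theorem Unanimous.eq_view {m : ℕ} {S : Finset α} {view : List α → Bool} {q : α} {v : Bool}
    (h : Unanimous m S view q v) : view [q] = v := by
  obtain ⟨Q, -, -, hQ⟩ := h
  simpa using hQ [] (by simp) (by simp)

theorem pslEntry_of_unanimous {m : ℕ} {S : Finset α} {view : List α → Bool} {q : α} {v : Bool}
    (h : Unanimous m S view q v) : pslEntry m S view q = some v := by
  have hp : pick (Unanimous m S view q) = some v :=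
    pick_eq_some h fun w hw => hw.eq_view.symm.trans h.eq_view
  cases m <;> simp [pslEntry, hp]

/-- Dropping the last sender `q` of every chain turns the views of depth `m + 1` on the value of
`q` into unanimous views of depth `m` on the values that the members of `Q` got from `q`. -/
theorem unanimous_erase [DecidableEq α] {m : ℕ} {S Q : Finset α} {view : List α → Bool} {q r : α}
    {v : Bool} (hq : q ∈ S) (hQS : Q ⊆ S) (hcard : S.card + (m + 1) < 2 * Q.card)
    (hQ : ∀ w : List α, w.length ≤ m + 1 → (∀ x ∈ w, x ∈ Q) → view (w ++ [q]) = v)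
    (hr : r ∈ Q) : Unanimous m (S.erase q) (fun w => view (w ++ [q])) r v := by
  refine ⟨Q.erase q, Finset.erase_subset_erase _ hQS, ?_, fun w hw hwQ => ?_⟩
  · have h1 := Finset.card_erase_of_mem hq
    have h2 := Finset.pred_card_le_card_erase (s := Q) (a := q)
    have h3 : 0 < S.card := Finset.card_pos.2 ⟨q, hq⟩
    omega
  · refine hQ (w ++ [r]) (by simpa using hw) fun x hx => ?_
    rcases List.mem_append.1 hx with hx | hx
    · exact Finset.mem_of_mem_erase (hwQ x hx)
    · rw [List.mem_singleton.1 hx]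
      exact hr

/-- A correct process relays through correct chains what it says itself. -/
theorem view_append_of_correct {S B : Finset α} {view : α → List α → Bool} {m : ℕ}
    (hview : ∀ p ∈ S, p ∉ B → ∀ q ∈ S, q ∉ B → ∀ w : List α, w.length ≤ m →
      view p (q :: w) = view q w)
    {q : α} (hq : q ∈ S) (hqB : q ∉ B) (w : List α) (hw : w.length ≤ m)
    (hwS : ∀ x ∈ w, x ∈ S ∧ x ∉ B) {p : α} (hp : p ∈ S) (hpB : p ∉ B) :
    view p (w ++ [q]) = view q [] := by
  induction w generalizing p with
  | nil => exact hview p hp hpB q hq hqB [] (by simp)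
  | cons x w ih =>
    have hx := hwS x (by simp)
    rw [List.length_cons] at hw
    rw [List.cons_append, hview p hp hpB x hx.1 hx.2 _ (by simpa using hw)]
    exact ih (by omega) (fun y hy => hwS y (by simp [hy])) hx.1 hx.2

open Classical in
theorem unanimous_of_correct {S B : Finset α} {view : α → List α → Bool} {m : ℕ}
    (hview : ∀ p ∈ S, p ∉ B → ∀ q ∈ S, q ∉ B → ∀ w : List α, w.length ≤ m →
      view p (q :: w) = view q w)
    (hB : (S.filter (· ∈ B)).card ≤ m) (hS : 3 * m + 1 ≤ S.card)
    {p q : α} (hp : p ∈ S) (hpB : p ∉ B) (hq : q ∈ S) (hqB : q ∉ B) :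
    Unanimous m S (view p) q (view q []) := by
  refine ⟨S.filter (· ∉ B), Finset.filter_subset _ _, ?_, fun w hw hwQ => ?_⟩
  · have := card_faulty_add_card_correct S B
    omega
  · exact view_append_of_correct hview hq hqB w hw
      (fun x hx => Finset.mem_filter.1 (hwQ x hx)) hp hpB

open Classical in
/-- Two correct processes that both find unanimity on the value of `q` find the same value,
because the two witnessing sets share a correct process. -/
theorem Unanimous.agree {S B : Finset α} {view : α → List α → Bool} {m : ℕ}
    (hview : ∀ p ∈ S, p ∉ B → ∀ q ∈ S, q ∉ B → ∀ w : List α, w.length ≤ m + 1 →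
      view p (q :: w) = view q w)
    (hB : (S.filter (· ∈ B)).card ≤ m + 1) {p p' q : α} (hp : p ∈ S) (hpB : p ∉ B)
    (hp' : p' ∈ S) (hpB' : p' ∉ B) {v v' : Bool} (h : Unanimous (m + 1) S (view p) q v)
    (h' : Unanimous (m + 1) S (view p') q v') : v' = v := by
  obtain ⟨Q, hQS, hcard, hQ⟩ := h
  obtain ⟨Q', hQS', hcard', hQ'⟩ := h'
  have hinter : ∃ r ∈ Q ∩ Q', r ∉ B := by
    by_contra! hall
    have h1 : (Q ∩ Q').card ≤ (S.filter (· ∈ B)).card := Finset.card_le_card fun r hr =>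
      Finset.mem_filter.2 ⟨hQS (Finset.mem_inter.1 hr).1, hall r hr⟩
    have h2 := Finset.card_union_add_card_inter Q Q'
    have h3 := Finset.card_le_card (Finset.union_subset hQS hQS')
    omega
  obtain ⟨r, hr, hrB⟩ := hinter
  obtain ⟨hrQ, hrQ'⟩ := Finset.mem_inter.1 hr
  have e := hQ [r] (by simp) (by simpa using hrQ)
  have e' := hQ' [r] (by simp) (by simpa using hrQ')
  rw [List.singleton_append, hview _ hp hpB r (hQS hrQ) hrB _ (by simp)] at e
  rw [List.singleton_append, hview _ hp' hpB' r (hQS hrQ) hrB _ (by simp)] at e'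
  exact e'.symm.trans e

open Classical in
/-- Interactive consistency: all correct processes compute the same entry. -/
theorem pslEntry_agree (m : ℕ) {S B : Finset α} {view : α → List α → Bool}
    (hview : ∀ p ∈ S, p ∉ B → ∀ q ∈ S, q ∉ B → ∀ w : List α, w.length ≤ m →
      view p (q :: w) = view q w)
    (hB : (S.filter (· ∈ B)).card ≤ m) (hS : 3 * m + 1 ≤ S.card)
    {p p' q : α} (hp : p ∈ S) (hpB : p ∉ B) (hp' : p' ∈ S) (hpB' : p' ∉ B) (hq : q ∈ S) :
    pslEntry m S (view p) q = pslEntry m S (view p') q := by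
  induction m generalizing S view p p' q with
  | zero =>
    have hqB : q ∉ B := fun h =>
      absurd (Finset.mem_filter.2 ⟨hq, h⟩)
        (by rw [Finset.card_eq_zero.1 (Nat.le_zero.1 hB)]; exact Finset.notMem_empty q)
    rw [pslEntry_of_unanimous (unanimous_of_correct hview hB hS hp hpB hq hqB),
      pslEntry_of_unanimous (unanimous_of_correct hview hB hS hp' hpB' hq hqB)]
  | succ m ih =>
    by_cases hqB : q ∈ B
    swap
    · rw [pslEntry_of_unanimous (unanimous_of_correct hview hB hS hp hpB hq hqB),
        pslEntry_of_unanimous (unanimous_of_correct hview hB hS hp' hpB' hq hqB)]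
    have hScard := Finset.card_erase_of_mem hq
    have hinner : ∀ {p p' r : α}, p ∈ S → p ∉ B → p' ∈ S → p' ∉ B → r ∈ S.erase q →
        pslEntry m (S.erase q) (fun w => view p (w ++ [q])) r =
          pslEntry m (S.erase q) (fun w => view p' (w ++ [q])) r := by
      intro p p' r hp hpB hp' hpB' hr
      refine ih (view := fun p w => view p (w ++ [q])) ?_ ?_ (by omega)
        (Finset.mem_erase.2 ⟨fun h => hpB (h ▸ hqB), hp⟩) hpB
        (Finset.mem_erase.2 ⟨fun h => hpB' (h ▸ hqB), hp'⟩) hpB' hr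
      · intro x hx hxB y hy hyB w hw
        exact hview x (Finset.mem_of_mem_erase hx) hxB y (Finset.mem_of_mem_erase hy) hyB _
          (by simpa using hw)
      · have hlt : ((S.erase q).filter (· ∈ B)).card < (S.filter (· ∈ B)).card := by
          refine Finset.card_lt_card (Finset.ssubset_iff.2
            ⟨q, by simp, Finset.insert_subset (Finset.mem_filter.2 ⟨hq, hqB⟩) ?_⟩)
          exact Finset.filter_subset_filter _ (Finset.erase_subset q S)
        omega
    -- a process that finds unanimity on `v` forces the others to record `v`
    have hmain : ∀ {p p' : α} {v : Bool}, p ∈ S → p ∉ B → p' ∈ S → p' ∉ B →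
        Unanimous (m + 1) S (view p) q v → pslEntry (m + 1) S (view p') q = some v := by
      intro p p' v hp hpB hp' hpB' hun
      cases hpick : pick (Unanimous (m + 1) S (view p') q) with
      | some v' =>
        have hun' := of_pick_eq_some hpick
        rw [pslEntry_of_unanimous hun', hun.agree hview hB hp hpB hp' hpB' hun']
      | none =>
        rw [pslEntry, hpick, Option.orElse_none]
        refine pick_eq_some ?_ fun w hw => ?_
        all_goals
          obtain ⟨Q, hQS, hcard, hQ⟩ := hun
          have hsub : Q.erase q ⊆ (S.erase q).filter fun r =>
              pslEntry m (S.erase q) (fun w => view p' (w ++ [q])) r = some v := by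
            intro r hr
            have hrS := Finset.erase_subset_erase q hQS hr
            refine Finset.mem_filter.2 ⟨hrS, ?_⟩
            rw [hinner hp' hpB' hp hpB hrS]
            exact pslEntry_of_unanimous
              (unanimous_erase hq hQS hcard hQ (Finset.mem_of_mem_erase hr))
          have h1 := Finset.card_le_card hsub
          have h2 := Finset.pred_card_le_card_erase (s := Q) (a := q)
        · omega
        · -- both values together would fill more than the `|S| - 1` entries there are
          by_contra hne
          have hdisj : Disjoint
              ((S.erase q).filter fun r =>
                pslEntry m (S.erase q) (fun w => view p' (w ++ [q])) r = some v)
              ((S.erase q).filter fun r =>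
                pslEntry m (S.erase q) (fun w => view p' (w ++ [q])) r = some w) :=
            Finset.disjoint_filter.2 fun r _ hr hr' =>
              hne (Option.some.inj (hr'.symm.trans hr))
          have h3 := Finset.card_le_card (Finset.union_subset
            (Finset.filter_subset (fun r =>
              pslEntry m (S.erase q) (fun w => view p' (w ++ [q])) r = some v) (S.erase q))
            (Finset.filter_subset (fun r =>
              pslEntry m (S.erase q) (fun w => view p' (w ++ [q])) r = some w) (S.erase q)))
          rw [Finset.card_union_of_disjoint hdisj] at h3
          have h4 : 0 < S.card := Finset.card_pos.2 ⟨q, hq⟩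
          omega
    cases h : pick (Unanimous (m + 1) S (view p) q) with
    | some v =>
      have hun := of_pick_eq_some h
      rw [hmain hp hpB hp' hpB' hun, pslEntry_of_unanimous hun]
    | none =>
      cases h' : pick (Unanimous (m + 1) S (view p') q) with
      | some v =>
        have hun := of_pick_eq_some h'
        rw [hmain hp' hpB' hp hpB hun, pslEntry_of_unanimous hun]
      | none =>
        have hfil : ∀ v : Bool,
            ((S.erase q).filter fun r =>
              pslEntry m (S.erase q) (fun w => view p (w ++ [q])) r = some v) =
            (S.erase q).filter fun r =>
              pslEntry m (S.erase q) (fun w => view p' (w ++ [q])) r = some v := fun v =>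
          Finset.filter_congr fun r hr => by rw [hinner hp hpB hp' hpB' hr]
        rw [pslEntry, pslEntry, h, h']
        simp only [hfil]

open Classical in
theorem pslDecision_agree {m : ℕ} {S B : Finset α} {view : α → List α → Bool}
    (hview : ∀ p ∈ S, p ∉ B → ∀ q ∈ S, q ∉ B → ∀ w : List α, w.length ≤ m →
      view p (q :: w) = view q w)
    (hB : (S.filter (· ∈ B)).card ≤ m) (hS : 3 * m + 1 ≤ S.card)
    {p p' : α} (hp : p ∈ S) (hpB : p ∉ B) (hp' : p' ∈ S) (hpB' : p' ∉ B) :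
    pslDecision m S (view p) = pslDecision m S (view p') := by
  have hfil : ∀ v : Bool, (S.filter fun q => pslEntry m S (view p) q = some v) =
      S.filter fun q => pslEntry m S (view p') q = some v := fun v =>
    Finset.filter_congr fun q hq => by
      rw [pslEntry_agree m hview hB hS hp hpB hp' hpB' hq]
  simp only [pslDecision, hfil]

open Classical in
theorem pslDecision_valid {m : ℕ} {S B : Finset α} {view : α → List α → Bool}
    (hview : ∀ p ∈ S, p ∉ B → ∀ q ∈ S, q ∉ B → ∀ w : List α, w.length ≤ m →
      view p (q :: w) = view q w)
    (hB : (S.filter (· ∈ B)).card ≤ m) (hS : 3 * m + 1 ≤ S.card) {v : Bool}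
    (hv : ∀ q ∈ S, q ∉ B → view q [] = v) {p : α} (hp : p ∈ S) (hpB : p ∉ B) :
    pslDecision m S (view p) = v := by
  have hentry : ∀ q ∈ S, q ∉ B → pslEntry m S (view p) q = some v := fun q hq hqB => by
    rw [pslEntry_of_unanimous (unanimous_of_correct hview hB hS hp hpB hq hqB), hv q hq hqB]
  have hgood : (S.filter (· ∉ B)).card ≤
      (S.filter fun q => pslEntry m S (view p) q = some v).card :=
    Finset.card_le_card fun q hq => by
      rw [Finset.mem_filter] at hq ⊢
      exact ⟨hq.1, hentry q hq.1 hq.2⟩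
  have hbad : (S.filter fun q => pslEntry m S (view p) q = some (!v)).card ≤
      (S.filter (· ∈ B)).card :=
    Finset.card_le_card fun q hq => by
      rw [Finset.mem_filter] at hq ⊢
      refine ⟨hq.1, by_contra fun hqB => ?_⟩
      simpa using (hentry q hq.1 hqB).symm.trans hq.2
  have hsplit := card_faulty_add_card_correct S B
  cases v
  · exact decide_eq_false (by simp only [Bool.not_false] at hbad; omega)
  · exact decide_eq_true (by simp only [Bool.not_true] at hbad; omega)

end PSL

/-! ### Computations of GENERIC -/

section Generic

variable {α : Type*} [Fintype α] {ℓ : ℝ} {pos : α → ℝ × ℝ} {k M : ℕ} {B : Finset α}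
  {input : α → Bool} {state : ℕ → α → GState α} {msg : ℕ → α → α → GMessage α}

theorem view_succ_of_length_ne (hc : IsComputation (generic ℓ pos k M) B input state msg)
    {p : α} (hpB : p ∉ B) {r : ℕ} {w : List α} (hw : w.length ≠ r + 1) :
    (state (r + 1) p).view w = (state r p).view w := by
  rw [hc.next_eq r p hpB]
  by_cases hp : p ∈ leaders ℓ pos
  · simp only [generic, if_pos hp]
    cases w with
    | nil => rfl
    | cons q w =>
      have : w.length ≠ r := fun h => hw (by simp [h])
      simp [this]
  · simp only [generic, if_neg hp]

theorem view_eq_of_length_le (hc : IsComputation (generic ℓ pos k M) B input state msg)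
    {p : α} (hpB : p ∉ B) {r r' : ℕ} (hr : r ≤ r') {w : List α} (hw : w.length ≤ r) :
    (state r' p).view w = (state r p).view w := by
  induction r', hr using Nat.le_induction with
  | base => rfl
  | succ r' hr ih => rw [view_succ_of_length_ne hc hpB (by omega), ih]

theorem view_nil (hc : IsComputation (generic ℓ pos k M) B input state msg) {p : α}
    (hpB : p ∉ B) (r : ℕ) : (state r p).view [] = input p := by
  rw [view_eq_of_length_le hc hpB (Nat.zero_le r) (by simp), hc.start_eq p hpB]
  simp [generic]

/-- After round `k * M`, what a correct leader has heard from another one along a chain is what the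
other one has heard. -/
theorem view_cons (hc : IsComputation (generic ℓ pos k M) B input state msg) {p q : α}
    (hp : p ∈ leaders ℓ pos) (hpB : p ∉ B) (hq : q ∈ leaders ℓ pos) (hqB : q ∉ B) {w : List α}
    (hw : w.length ≤ k * M) :
    (state (k * M + 1) p).view (q :: w) = (state (k * M + 1) q).view w := by
  rw [view_eq_of_length_le hc hpB (r := w.length + 1) (by omega) (by simp),
    view_eq_of_length_le hc hqB (r := w.length) (by omega) le_rfl, hc.next_eq _ p hpB]
  simp only [hc.send_eq, hqB, not_false_eq_true, generic, hp, hq, hw, if_true, true_and,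
    GMessage.read]

theorem leader_decision_eq_none (hc : IsComputation (generic ℓ pos k M) B input state msg)
    {p : α} (hp : p ∈ leaders ℓ pos) (hpB : p ∉ B) {r : ℕ} (hr : r ≤ k * M) :
    (state r p).decision = none := by
  induction r with
  | zero => rw [hc.start_eq p hpB]; rfl
  | succ r ih =>
    rw [hc.next_eq r p hpB]
    simp only [generic, if_pos hp, if_neg (show r ≠ k * M by omega)]
    exact ih (by omega)

theorem leader_decision_eq_some (hc : IsComputation (generic ℓ pos k M) B input state msg)
    {p : α} (hp : p ∈ leaders ℓ pos) (hpB : p ∉ B) {r : ℕ} (hr : k * M + 1 ≤ r) :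
    (state r p).decision =
      some (pslDecision (k * M) (leaders ℓ pos) (state (k * M + 1) p).view) := by
  induction r, hr using Nat.le_induction with
  | base =>
    rw [hc.next_eq (k * M) p hpB]
    simp only [generic, if_pos hp, if_true]
  | succ r hr ih =>
    rw [hc.next_eq r p hpB]
    simp only [generic, if_pos hp, if_neg (show r ≠ k * M by omega)]
    exact ih

open Classical in
/-- The correct leaders reach consensus among themselves. -/
theorem exists_leader_consensus (hc : IsComputation (generic ℓ pos k M) B input state msg)
    (hB : ((leaders ℓ pos).filter (· ∈ B)).card ≤ k * M)
    (hL : 3 * (k * M) + 1 ≤ (leaders ℓ pos).card) :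
    ∃ d, (∀ p ∈ leaders ℓ pos, p ∉ B →
        pslDecision (k * M) (leaders ℓ pos) (state (k * M + 1) p).view = d) ∧
      ∀ v, (∀ p, p ∉ B → input p = v) → d = v := by
  have hview : ∀ p ∈ leaders ℓ pos, p ∉ B → ∀ q ∈ leaders ℓ pos, q ∉ B →
      ∀ w : List α, w.length ≤ k * M →
      (state (k * M + 1) p).view (q :: w) = (state (k * M + 1) q).view w :=
    fun p hp hpB q hq hqB w hw => view_cons hc hp hpB hq hqB hw
  have hex : ∃ p ∈ leaders ℓ pos, p ∉ B := by
    by_contra! hall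
    rw [Finset.filter_true_of_mem hall] at hB
    omega
  obtain ⟨p₀, hp₀, hpB₀⟩ := hex
  exact ⟨_, fun p hp hpB => pslDecision_agree (view := fun p => (state (k * M + 1) p).view)
      hview hB hL hp hpB hp₀ hpB₀,
    fun v hv => pslDecision_valid (view := fun p => (state (k * M + 1) p).view) hview hB hL
      (fun q _ hqB => (view_nil hc hqB _).trans (hv q hqB)) hp₀ hpB₀⟩

theorem decision_irrevocable (hc : IsComputation (generic ℓ pos k M) B input state msg)
    {p : α} (hpB : p ∉ B) {r r' : ℕ} (hr : r ≤ r') {v : Bool}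
    (h : (state r p).decision = some v) : (state r' p).decision = some v := by
  induction r', hr using Nat.le_induction with
  | base => exact h
  | succ r' hr ih =>
    by_cases hp : p ∈ leaders ℓ pos
    · rcases Nat.lt_or_ge (k * M) r' with hr' | hr'
      · rw [leader_decision_eq_some hc hp hpB (by omega)] at ih ⊢
        exact ih
      · rw [leader_decision_eq_none hc hp hpB hr'] at ih
        exact absurd ih (by simp)
    · rw [hc.next_eq r' p hpB]
      simp only [generic, if_neg hp, ih]
      rfl

/-- A correct leader announces no value other than its decision. -/
theorem send_decided (hc : IsComputation (generic ℓ pos k M) B input state msg) {q : α}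
    (hqB : q ∉ B) (hq : q ∈ leaders ℓ pos) {r : ℕ} {p : α} {v : Bool}
    (h : msg r q p = .decided v) :
    v = pslDecision (k * M) (leaders ℓ pos) (state (k * M + 1) q).view := by
  rw [hc.send_eq r q hqB p] at h
  simp only [generic, if_pos hq] at h
  split_ifs at h with h₁ h₂ h₃
  subst h₃
  rw [leader_decision_eq_some hc hq hqB le_rfl] at h
  exact (GMessage.decided.inj h).symm

theorem send_decision_round (hc : IsComputation (generic ℓ pos k M) B input state msg) {q : α}
    (hqB : q ∉ B) (hq : q ∈ leaders ℓ pos) (p : α) :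
    msg (k * M + 1) q p =
      .decided (pslDecision (k * M) (leaders ℓ pos) (state (k * M + 1) q).view) := by
  rw [hc.send_eq _ q hqB p]
  simp [generic, hq, leader_decision_eq_some hc hq hqB le_rfl]

open Classical in
theorem heard_succ (hc : IsComputation (generic ℓ pos k M) B input state msg) {p : α}
    (hp : p ∉ leaders ℓ pos) (hpB : p ∉ B) (r : ℕ) (v : Bool) :
    (state (r + 1) p).heard v =
      (state r p).heard v ∪ (leaders ℓ pos).filter fun q => msg r q p = .decided v := by
  rw [hc.next_eq r p hpB]
  simp only [generic, if_neg hp]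

theorem decision_succ (hc : IsComputation (generic ℓ pos k M) B input state msg) {p : α}
    (hp : p ∉ leaders ℓ pos) (hpB : p ∉ B) (r : ℕ) :
    (state (r + 1) p).decision = (state r p).decision.orElse fun _ =>
      pick fun v => 2 * (k * M) + 1 ≤ ((state (r + 1) p).heard v).card := by
  simp only [heard_succ hc hp hpB]
  rw [hc.next_eq r p hpB]
  simp only [generic, if_neg hp]

open Classical in
/-- A correct process that is not a leader hears a value other than the decision `d` of the
correct leaders from faulty leaders only. -/
theorem heard_subset_faulty (hc : IsComputation (generic ℓ pos k M) B input state msg) {d : Bool}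
    (hd : ∀ p ∈ leaders ℓ pos, p ∉ B →
      pslDecision (k * M) (leaders ℓ pos) (state (k * M + 1) p).view = d)
    {p : α} (hp : p ∉ leaders ℓ pos) (hpB : p ∉ B) (r : ℕ) {v : Bool} (hv : v ≠ d) :
    (state r p).heard v ⊆ (leaders ℓ pos).filter (· ∈ B) := by
  induction r with
  | zero => rw [hc.start_eq p hpB]; exact Finset.empty_subset _
  | succ r ih =>
    rw [heard_succ hc hp hpB]
    refine Finset.union_subset ih fun q hq => ?_
    obtain ⟨hqL, hqm⟩ := Finset.mem_filter.1 hq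
    refine Finset.mem_filter.2 ⟨hqL, by_contra fun hqB => hv ?_⟩
    rw [send_decided hc hqB hqL hqm, hd q hqL hqB]

open Classical in
theorem follower_decision (hc : IsComputation (generic ℓ pos k M) B input state msg)
    (hB : ((leaders ℓ pos).filter (· ∈ B)).card ≤ k * M) {d : Bool}
    (hd : ∀ p ∈ leaders ℓ pos, p ∉ B →
      pslDecision (k * M) (leaders ℓ pos) (state (k * M + 1) p).view = d)
    {p : α} (hp : p ∉ leaders ℓ pos) (hpB : p ∉ B) (r : ℕ) {v : Bool}
    (h : (state r p).decision = some v) : v = d := by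
  induction r with
  | zero =>
    rw [hc.start_eq p hpB] at h
    exact absurd h (by simp [generic])
  | succ r ih =>
    rw [decision_succ hc hp hpB] at h
    cases hdec : (state r p).decision with
    | some w =>
      rw [hdec] at h
      exact ih (hdec.trans h)
    | none =>
      rw [hdec, Option.orElse_none] at h
      by_contra hv
      have h1 := Finset.card_le_card (heard_subset_faulty hc hd hp hpB (r + 1) hv)
      have h2 := of_pick_eq_some h
      omega

open Classical in
theorem follower_decides (hc : IsComputation (generic ℓ pos k M) B input state msg)
    (hB : ((leaders ℓ pos).filter (· ∈ B)).card ≤ k * M)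
    (hL : 3 * (k * M) + 1 ≤ (leaders ℓ pos).card) {d : Bool}
    (hd : ∀ p ∈ leaders ℓ pos, p ∉ B →
      pslDecision (k * M) (leaders ℓ pos) (state (k * M + 1) p).view = d)
    {p : α} (hp : p ∉ leaders ℓ pos) (hpB : p ∉ B) :
    (state (k * M + 2) p).decision = some d := by
  cases h : (state (k * M + 2) p).decision with
  | some v => rw [follower_decision hc hB hd hp hpB _ h]
  | none =>
    rw [decision_succ hc hp hpB (k * M + 1)] at h
    have hpick : pick (fun v => 2 * (k * M) + 1 ≤ ((state (k * M + 1 + 1) p).heard v).card) =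
        none := by
      cases hdec : (state (k * M + 1) p).decision with
      | some w => rw [hdec] at h; exact absurd h (by simp)
      | none => rw [hdec] at h; exact h
    refine absurd ?_ (pick_eq_none hpick d)
    have hsub : (leaders ℓ pos).filter (· ∉ B) ⊆ (state (k * M + 1 + 1) p).heard d := by
      intro q hq
      obtain ⟨hqL, hqB⟩ := Finset.mem_filter.1 hq
      rw [heard_succ hc hp hpB]
      exact Finset.mem_union_right _ (Finset.mem_filter.2
        ⟨hqL, by rw [send_decision_round hc hqB hqL, hd q hqL hqB]⟩)
    have h1 := Finset.card_le_card hsub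
    have h2 := card_faulty_add_card_correct (leaders ℓ pos) B
    omega

open Classical in
theorem generic_reachesConsensus (hc : IsComputation (generic ℓ pos k M) B input state msg)
    (hB : ((leaders ℓ pos).filter (· ∈ B)).card ≤ k * M)
    (hL : 3 * (k * M) + 1 ≤ (leaders ℓ pos).card) :
    ReachesConsensus (generic ℓ pos k M) B input state (k * M + 2) := by
  obtain ⟨d, hd, hvalid⟩ := exists_leader_consensus hc hB hL
  have hsome : ∀ p, p ∉ B → ∀ r v, (state r p).decision = some v → v = d := by
    intro p hpB r v h
    by_cases hp : p ∈ leaders ℓ pos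
    · rcases Nat.lt_or_ge (k * M) r with hr | hr
      · rw [leader_decision_eq_some hc hp hpB hr, hd p hp hpB] at h
        exact (Option.some.inj h).symm
      · rw [leader_decision_eq_none hc hp hpB hr] at h
        exact absurd h (by simp)
    · exact follower_decision hc hB hd hp hpB r h
  have hterm : ∀ p, p ∉ B → (state (k * M + 2) p).decision = some d := by
    intro p hpB
    by_cases hp : p ∈ leaders ℓ pos
    · rw [leader_decision_eq_some hc hp hpB (by omega), hd p hp hpB]
    · exact follower_decides hc hB hL hd hp hpB
  exact
    { irrevocable := fun p hpB r r' v hr h => decision_irrevocable hc hpB hr h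
      agreement := fun p hpB q hqB r r' v w hv hw =>
        (hsome p hpB r v hv).trans (hsome q hqB r' w hw).symm
      validity := fun v hv p hpB => ⟨k * M + 2, hvalid v hv ▸ hterm p hpB⟩
      termination := fun p hpB => ⟨d, hterm p hpB⟩ }

/-- If no fault area overlaps more than `k` cover squares and there are `k * M + c` of these, then
at least `c` leaders are correct; for `c > 2 * k * M` this makes GENERIC work. -/
theorem generic_tolerates (hℓ : 0 < ℓ) (hpos : Function.Injective pos) {F : Fin M → Set (ℝ × ℝ)}
    (hF : ∀ i, (overlapped ℓ pos (F i)).card ≤ k) {c : ℕ} (hc : 2 * (k * M) + 1 ≤ c)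
    (hcover : k * M + c ≤ (squareCover ℓ pos).card) :
    (∀ B : Finset α, CoveredBy pos F B → B.card + c ≤ Fintype.card α) ∧
      SolvesGeoconsensus (generic ℓ pos k M) pos F (k * M + 2) := by
  classical
  have hL := hcover.trans (card_squareCover_le_card_leaders hℓ.le pos)
  refine ⟨fun B hB => ?_, fun B hB input state msg hcomp => ?_⟩
  · have h1 : ((leaders ℓ pos).filter (· ∈ B)).card ≤ k * M := by
      convert card_faulty_leaders_le hpos hF hB
    have h2 := card_faulty_add_card_correct (leaders ℓ pos) B
    have h3 : Disjoint B ((leaders ℓ pos).filter (· ∉ B)) :=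
      Finset.disjoint_right.2 fun p hp => (Finset.mem_filter.1 hp).2
    have h4 := Finset.card_le_univ (B ∪ (leaders ℓ pos).filter (· ∉ B))
    rw [Finset.card_union_of_disjoint h3] at h4
    omega
  · exact generic_reachesConsensus hcomp (card_faulty_leaders_le hpos hF hB) (by omega)

end Generic

theorem mainTheorem3 (N M : ℕ) (hM : 1 ≤ M) (ℓ : ℝ) (hℓ : 0 < ℓ)
    (pos : Fin N → ℝ × ℝ) (hpos : Function.Injective pos) (F : Fin M → Set (ℝ × ℝ)) :
    ((∀ i, IsSquareOfSide ℓ (F i)) → 22 * M ≤ (squareCover ℓ pos).card →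
      (∀ B : Finset (Fin N), CoveredBy pos F B → B.card + 15 * M ≤ N) ∧
        SolvesGeoconsensus (generic ℓ pos 7 M) pos F (7 * M + 2)) ∧
    ((∀ i, IsAxisSquareOfSide ℓ (F i)) → 13 * M ≤ (squareCover ℓ pos).card →
      (∀ B : Finset (Fin N), CoveredBy pos F B → B.card + 9 * M ≤ N) ∧
        SolvesGeoconsensus (generic ℓ pos 4 M) pos F (4 * M + 2)) ∧
    ((∀ i, IsSquareOfSide (ℓ / Real.sqrt 2) (F i)) → 13 * M ≤ (squareCover ℓ pos).card →
      (∀ B : Finset (Fin N), CoveredBy pos F B → B.card + 9 * M ≤ N) ∧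
        SolvesGeoconsensus (generic ℓ pos 4 M) pos F (4 * M + 2)) := by
  refine ⟨fun hF hcover => ?_, fun hF hcover => ?_, fun hF hcover => ?_⟩
  · simpa only [Fintype.card_fin] using generic_tolerates hℓ hpos
      (fun i => card_overlapped_le_seven hℓ (hF i)) (c := 15 * M) (by omega) (by omega)
  · simpa only [Fintype.card_fin] using generic_tolerates hℓ hpos
      (fun i => card_overlapped_le_four_of_axisSquare (hF i)) (c := 9 * M) (by omega) (by omega)
  · simpa only [Fintype.card_fin] using generic_tolerates hℓ hpos
      (fun i => card_overlapped_le_four_of_small_square hℓ (hF i)) (c := 9 * M)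
      (by omega) (by omega)
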